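/- (Strong divergence of the multilevel Monte Carlo Euler method.) Let $T\in(0,\infty)$, let $(\Omega,\mathcal F,\mathbb P)$ be a probability space with a normal filtration $(\mathcal F_t)_{t\in[0,T]}$ (right-continuous, with $\mathcal F_0$ containing all $\mathbb P$-null events of $\mathcal F$), let $W^{l,k}\colon[0,T]\times\Omega\to\mathbb R$, $l\in\{0,1,2,\dots\}$, $k\in\{1,2,\dots\}$, be independent one-dimensional standard $(\mathcal F_t)_{t\in[0,T]}$-Brownian motions, and let $\xi^{l,k}\colon\Omega\to\mathbb R$ be independent identically distributed $\mathcal F_0$-measurable random variables with $\mathbb E[|\xi^{0,1}|^p]<\infty$ for all $p\in[1,\infty)$. Let $\mu,\sigma\colon\mathbb R\to\mathbb R$ be continuous and let $X\colon[0,T]\times\Omega\to\mathbb R$ be a predictable process such that $\int_0^T|\mu(X_s)|+|\sigma(X_s)|^2\,ds<\infty$ $\mathbb P$-almost surely and, for every $t\in[0,T]$, \[ X_t=\xi^{0,1}+\int_0^t\mu(X_s)\,ds+\int_0^t\sigma(X_s)\,dW^{0,1}_s\qquad\mathbb P\text{-almost surely}. \] Define the Euler approximations by $Y^{N,l,k}_0:=\xi^{l,k}$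 and, for $n\in\{0,\dots,N-1\}$, \[ Y^{N,l,k}_{n+1}:=Y^{N,l,k}_n+\mu(Y^{N,l,k}_n)\tfrac TN+\sigma(Y^{N,l,k}_n)\bigl(W^{l,k}_{(n+1)T/N}-W^{l,k}_{nT/N}\bigr). \] Let $\alpha,c\in(1,\infty)$ be such that \[ \frac{|x|^\alpha}{c}\le|\mu(x)|+|\sigma(x)|\le c|x|^c\qquad\text{for all }x\in\mathbb R\text{ with }|x|\ge c. \] Assume that $\mathbb P[\sigma(\xi^{0,1})\ne0]>0$, or that there is $\beta\in(1,\infty)$ with $\mathbb P[|\xi^{0,1}|\ge x]\ge\beta^{(-x^\beta)}$ for all $x\in[1,\infty)$. Let $f\colon\mathbb R\to\mathbb R$ be Borel measurable with \[ \tfrac1c|x|^{1/c}-c\le f(x)\le c(1+|x|^c)\qquad\text{for all }x\in\mathbb R. \] Then, for every $p\in[1,\infty)$, \[ \lim_{\substack{N\to\infty\\ \log_2(N)\in\mathbb N}}\mathbb E\left[\left|\mathbb E[f(X_T)]-\frac1N\sum_{k=1}^N f(Y^{1,0,k}_1)-\sum_{l=1}^{\log_2(N)}\frac{2^l}{N}\sum_{k=1}^{N/2^l}\Bigl(f(Y^{2^l,l,k}_{2^l})-f(Y^{2^{l-1},l,k}_{2^{l-1}})\Bigr)\right|^p\right]=\infty.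 \] Here $\mathbb E[f(X_T)]\in(-\infty,\infty]$, which is well defined since $f\ge-c$; if it equals $\infty$, the error is $\infty$. -/

import Mathlib

open MeasureTheory ProbabilityTheory Filter Topology
open scoped NNReal ENNReal

noncomputable section

namespace MLMCEuler

/-- The time interval `[0, T]`. -/
abbrev TimeInterval (T : ℝ) : Type := Set.Icc (0 : ℝ) T

instance instFactLe {T : ℝ} [h : Fact (0 < T)] : Fact (0 ≤ T) := ⟨h.out.le⟩

/-- Lebesgue measure on `[0, T]`. -/
def timeVolume (T : ℝ) : Measure (TimeInterval T) := Measure.comap Subtype.val volume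

/-- A filtration on `[0, T]` is normal if it is right-continuous and its initial σ-algebra
contains all events of probability zero. -/
structure IsNormalFiltration {Ω : Type*} {mΩ : MeasurableSpace Ω} {T : ℝ} [Fact (0 < T)]
    (𝓕 : Filtration (TimeInterval T) mΩ) (P : Measure Ω) : Prop where
  rightContinuous : 𝓕.IsRightContinuous
  nullSets : ∀ A : Set Ω, MeasurableSet A → P A = 0 → MeasurableSet[𝓕 ⊥] A

/-- `W` is a one-dimensional standard Brownian motion on `[0, T]` with respect to the
filtration `𝓕`: it is adapted, starts at zero, has continuous paths (both almost surely), and for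
`s ≤ t` the increment `W t - W s` is centered Gaussian with variance `t - s` and independent of
`𝓕 s`. -/
structure IsStandardBrownianMotion {Ω : Type*} {mΩ : MeasurableSpace Ω} {T : ℝ} [Fact (0 < T)]
    (𝓕 : Filtration (TimeInterval T) mΩ) (P : Measure Ω) (W : TimeInterval T → Ω → ℝ) :
    Prop where
  adapted : ∀ t, Measurable[𝓕 t] (W t)
  start_zero : ∀ᵐ ω ∂P, W ⊥ ω = 0
  continuous_paths : ∀ᵐ ω ∂P, Continuous fun t => W t ω
  increment_law : ∀ s t : TimeInterval T, s ≤ t →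
    HasLaw (fun ω => W t ω - W s ω) (gaussianReal 0 (Real.toNNReal ((t : ℝ) - (s : ℝ)))) P
  increment_indep : ∀ s t : TimeInterval T, s ≤ t →
    Indep (MeasurableSpace.comap (fun ω => W t ω - W s ω) (borel ℝ)) (𝓕 s) P

/-- Elementary predictable processes `∑ i, η i * 1_{(a i, b i]}` on `[0, T]` with bounded
`𝓕 (a i)`-measurable coefficients `η i`. -/
structure ElementaryProcess {Ω : Type*} {mΩ : MeasurableSpace Ω} {T : ℝ}
    (𝓕 : Filtration (TimeInterval T) mΩ) where
  size : ℕ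
  a : Fin size → TimeInterval T
  b : Fin size → TimeInterval T
  a_le_b : ∀ i, a i ≤ b i
  η : Fin size → Ω → ℝ
  measurable_η : ∀ i, Measurable[𝓕 (a i)] (η i)
  bounded_η : ∃ C : ℝ, ∀ i ω, |η i ω| ≤ C

namespace ElementaryProcess

variable {Ω : Type*} {mΩ : MeasurableSpace Ω} {T : ℝ} {𝓕 : Filtration (TimeInterval T) mΩ}

/-- The value of an elementary process at time `s`. -/
def eval (H : ElementaryProcess 𝓕) (s : TimeInterval T) (ω : Ω) : ℝ :=
  ∑ i, (Set.Ioc (H.a i) (H.b i)).indicator (fun _ => H.η i ω) s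

/-- The stochastic integral of an elementary process against `W` over `(0, t]`. -/
def integral (H : ElementaryProcess 𝓕) (W : TimeInterval T → Ω → ℝ) (t : TimeInterval T)
    (ω : Ω) : ℝ :=
  ∑ i, H.η i ω * (W (min (H.b i) t) ω - W (min (H.a i) t) ω)

end ElementaryProcess

/-- The random variable `J` is (a version of) the Itô integral `∫₀ᵗ H dW`: there are elementary
processes `Hₙ` with `∫₀ᵗ |Hₙ - H|² ds → 0` in probability whose elementary integrals up to time `t`
converge to `J` in probability. For a Brownian motion `W` with respect to `𝓕` and a predictable
process `H` with `∫₀ᵗ |H|² ds < ∞` almost surely, such a `J` exists and is almost surely unique. -/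
def IsItoIntegral {Ω : Type*} {mΩ : MeasurableSpace Ω} {T : ℝ}
    (𝓕 : Filtration (TimeInterval T) mΩ) (P : Measure Ω) (W : TimeInterval T → Ω → ℝ)
    (H : TimeInterval T → Ω → ℝ) (t : TimeInterval T) (J : Ω → ℝ) : Prop :=
  ∃ E : ℕ → ElementaryProcess 𝓕,
    (∀ ε : ℝ≥0∞, 0 < ε → Tendsto (fun n => P {ω | ε ≤
      ∫⁻ s in Set.Iic t, ENNReal.ofReal (((E n).eval s ω - H s ω) ^ 2) ∂(timeVolume T)}) atTop (𝓝 0)) ∧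
    TendstoInMeasure P (fun n => (E n).integral W t) atTop J

/-- `X` is a solution on `[0, T]` of `dX = μ(X) dt + σ(X) dW`, `X₀ = ξ`: it is predictable,
`∫₀ᵀ |μ(X_s)| + |σ(X_s)|² ds < ∞` almost surely, and for every `t` the integral equation holds
almost surely. -/
structure IsSDESolution {Ω : Type*} {mΩ : MeasurableSpace Ω} {T : ℝ} [Fact (0 < T)]
    (𝓕 : Filtration (TimeInterval T) mΩ) (P : Measure Ω) (W : TimeInterval T → Ω → ℝ)
    (ξ : Ω → ℝ) (μ σ : ℝ → ℝ) (X : TimeInterval T → Ω → ℝ) : Prop where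
  predictable : IsStronglyPredictable 𝓕 X
  integrable : ∀ᵐ ω ∂P,
    ∫⁻ s, ENNReal.ofReal (|μ (X s ω)| + |σ (X s ω)| ^ 2) ∂(timeVolume T) < ∞
  equation : ∀ t : TimeInterval T, ∃ J : Ω → ℝ,
    IsItoIntegral 𝓕 P W (fun s ω => σ (X s ω)) t J ∧
    ∀ᵐ ω ∂P, X t ω = ξ ω + (∫ s in Set.Iic t, μ (X s ω) ∂(timeVolume T)) + J ω

/-- The grid point `n T / N` of `[0, T]`, for `n ≤ N`. -/
def gridTime (T : ℝ) [Fact (0 < T)] (N n : ℕ) : TimeInterval T :=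
  Set.projIcc 0 T Fact.out ((n : ℝ) * T / N)

/-- The Euler approximation with `N` time steps of size `T / N` driven by `W` and started in `ξ`,
after `n` steps, for `n ≤ N`. -/
def euler {Ω : Type*} {T : ℝ} [Fact (0 < T)] (μ σ : ℝ → ℝ) (W : TimeInterval T → Ω → ℝ)
    (ξ : Ω → ℝ) (N : ℕ) : ℕ → Ω → ℝ
  | 0 => ξ
  | n + 1 => fun ω =>
      euler μ σ W ξ N n ω + μ (euler μ σ W ξ N n ω) * (T / N)
        + σ (euler μ σ W ξ N n ω) * (W (gridTime T N (n + 1)) ω - W (gridTime T N n) ω)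

/-- The multilevel Monte Carlo Euler approximation of `E[f(X_T)]` for `N` a power of two. The
second index of `W` and `ξ` numbers the copies from `0`, so the paths used on level `l` are those
with second index in `{0, …, N / 2 ^ l - 1}`. -/
def mlmcEuler {Ω : Type*} {T : ℝ} [Fact (0 < T)] (μ σ : ℝ → ℝ)
    (W : ℕ → ℕ → TimeInterval T → Ω → ℝ) (ξ : ℕ → ℕ → Ω → ℝ) (f : ℝ → ℝ) (N : ℕ) (ω : Ω) : ℝ :=
  (1 / (N : ℝ)) * ∑ k ∈ Finset.range N, f (euler μ σ (W 0 k) (ξ 0 k) 1 1 ω)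
    + ∑ l ∈ Finset.Icc 1 (Nat.log 2 N), ((2 : ℝ) ^ l / (N : ℝ)) *
        ∑ k ∈ Finset.range (N / 2 ^ l),
          (f (euler μ σ (W l k) (ξ l k) (2 ^ l) (2 ^ l) ω)
            - f (euler μ σ (W l k) (ξ l k) (2 ^ (l - 1)) (2 ^ (l - 1)) ω))

/-- The expectation `E[Z] = E[Z⁺] - E[Z⁻]` as an extended real number, for `Z` with
`E[Z⁻] < ∞`; it equals `∞` if moreover `E[|Z|] = ∞`. -/
def extExpectation {Ω : Type*} {mΩ : MeasurableSpace Ω} (P : Measure Ω) (Z : Ω → ℝ) : EReal :=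
  ((∫⁻ ω, ENNReal.ofReal (Z ω) ∂P : ℝ≥0∞) : EReal)
    - ((∫⁻ ω, ENNReal.ofReal (-Z ω) ∂P : ℝ≥0∞) : EReal)

end MLMCEuler

end

/-! All paths at a fixed step number have the same law, so the multilevel sum telescopes in
expectation: for N = 2^L the estimator has mean E[f(Y_N)], where Y is one Euler path with N steps.
The L^p error controls the bias from above, so it suffices that E[f(Y_N)] tends to infinity, and by
the lower bound on f that E[|Y_N|^s] does for s = 1/c.

This divergence (`tendsto_integral_abs_rpow_euler`) comes from events that are rare but not rare
enough. Superlinear growth makes one step raise a level r to r^γ, γ = (1+α)/2 > 1, as soon as r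
beats a power of N. This only needs the Brownian increment to exceed the step size on the favourable
side, which has conditional probability at least q > 0 uniformly in N
(`stepProb_mul_le_euler_succ`). Noise or heavy tails bring |Y_1| to a level r polynomial in N with
probability at least a·exp(-A N^m). Hence |Y_N| ≥ r^(γ^(N-1)) with probability at least
q^(N-1)·a·exp(-A N^m), and by Markov's inequality the doubly exponential size outweighs the
probability. -/

namespace MLMCEuler

/-! ### Gaussian tails and the growth of a single step -/

/-- A lower bound for the Gaussian tail. -/
lemma le_gaussianReal_real_Ici {v : ℝ≥0} (hv : v ≠ 0) {x : ℝ} (hx : 0 ≤ x) :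
    (√(2 * Real.pi))⁻¹ * Real.exp (-(x ^ 2 / v + 1)) ≤ (gaussianReal 0 v).real (Set.Ici x) := by
  have hv0 : (0 : ℝ) < v := by positivity
  set m : ℝ := (√(2 * Real.pi * v))⁻¹ * Real.exp (-(x ^ 2 / v + 1)) with hm
  have hs : 0 < √(v : ℝ) := Real.sqrt_pos.2 hv0
  have hs2 : √(v : ℝ) ^ 2 = v := Real.sq_sqrt hv0.le
  -- On an interval of one standard deviation, (x + √v)² ≤ 2(x² + v) bounds the density below; the
  -- length √v cancels the normalisation 1/√v.
  have hpdf : ∀ u ∈ Set.Icc x (x + √(v : ℝ)), ENNReal.ofReal m ≤ gaussianPDF 0 v u := by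
    intro u hu
    rw [gaussianPDF_def, gaussianPDFReal_def]
    refine ENNReal.ofReal_le_ofReal ?_
    rw [hm]
    refine mul_le_mul_of_nonneg_left (Real.exp_le_exp.2 ?_) (by positivity)
    rw [neg_div, neg_le_neg_iff, div_add_one hv0.ne', div_le_div_iff₀ (by positivity) hv0]
    have h1 : (u - 0) ^ 2 ≤ 2 * (x ^ 2 + v) := by
      have h2 : u ^ 2 ≤ (x + √(v : ℝ)) ^ 2 := by
        have := hu.1; have := hu.2
        gcongr
        linarith
      nlinarith [sq_nonneg (x - √(v : ℝ))]
    nlinarith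
  have key : ENNReal.ofReal (m * √(v : ℝ)) ≤ gaussianReal 0 v (Set.Ici x) := by
    calc ENNReal.ofReal (m * √(v : ℝ))
        = ∫⁻ _ in Set.Icc x (x + √(v : ℝ)), ENNReal.ofReal m := by
          rw [setLIntegral_const, Real.volume_Icc, add_sub_cancel_left,
            ENNReal.ofReal_mul (by positivity)]
      _ ≤ ∫⁻ u in Set.Icc x (x + √(v : ℝ)), gaussianPDF 0 v u :=
          setLIntegral_mono' measurableSet_Icc hpdf
      _ = gaussianReal 0 v (Set.Icc x (x + √(v : ℝ))) := (gaussianReal_apply 0 hv _).symm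
      _ ≤ gaussianReal 0 v (Set.Ici x) := measure_mono fun u hu => hu.1
  have hmv : m * √(v : ℝ) = (√(2 * Real.pi))⁻¹ * Real.exp (-(x ^ 2 / v + 1)) := by
    rw [hm, Real.sqrt_mul (by positivity)]
    field_simp
  rw [← hmv]
  exact (ENNReal.ofReal_le_iff_le_toReal (measure_ne_top _ _)).1 key

lemma gaussianReal_real_Iic_neg (v : ℝ≥0) (x : ℝ) :
    (gaussianReal 0 v).real (Set.Iic (-x)) = (gaussianReal 0 v).real (Set.Ici x) := by
  have h : (gaussianReal 0 v).map (fun y => -y) = gaussianReal 0 v := by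
    rw [gaussianReal_map_neg, neg_zero]
  conv_lhs => rw [← h]
  rw [map_measureReal_apply measurable_neg measurableSet_Iic]
  congr 1
  ext y
  simp

/-- Either alternative gives `a` and `b * w` weakly the same sign, so their absolute values add. -/
lemma abs_add_mul_le_abs_add_mul {a b x w : ℝ} (hx : 0 ≤ x)
    (h : (0 ≤ a * b ∧ x ≤ w) ∨ (a * b < 0 ∧ w ≤ -x)) :
    |a| + |b| * x ≤ |a + b * w| := by
  have h1 : 0 ≤ a * (b * w) := by
    rcases h with ⟨h, h'⟩ | ⟨h, h'⟩
    · rw [← mul_assoc]; exact mul_nonneg h (hx.trans h')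
    · rw [← mul_assoc]; exact mul_nonneg_of_nonpos_of_nonpos h.le (by linarith)
  have h2 : |a + b * w| = |a| + |b * w| := by
    rw [abs_add_eq_add_abs_iff]
    rcases le_total 0 a with ha | ha <;> rcases le_total 0 (b * w) with hb | hb
    · exact Or.inl ⟨ha, hb⟩
    · rcases eq_or_lt_of_le ha with ha' | ha'
      · exact Or.inr ⟨ha'.symm.le, hb⟩
      · exact Or.inl ⟨ha, nonneg_of_mul_nonneg_right h1 ha'⟩
    · rcases eq_or_lt_of_le ha with ha' | ha'
      · exact Or.inl ⟨ha'.symm.le, hb⟩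
      · exact Or.inr ⟨ha, by nlinarith⟩
    · exact Or.inr ⟨ha, hb⟩
  have h3 : x ≤ |w| := by
    rcases h with ⟨-, h'⟩ | ⟨-, h'⟩
    · exact h'.trans (le_abs_self w)
    · exact (by linarith : x ≤ -w).trans (neg_le_abs w)
  rw [h2, abs_mul]
  gcongr

/-- Choosing the sign of an independent Gaussian increment `D` so that no cancellation occurs in
`a Y + b Y * D`. -/
lemma measureReal_mul_le_abs_add_mul {Ω : Type*} {m mΩ : MeasurableSpace Ω} {P : Measure Ω}
    [IsProbabilityMeasure P] (hm : m ≤ mΩ) {Y D : Ω → ℝ} {v : ℝ≥0} (hY : Measurable[m] Y)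
    (hD : HasLaw D (gaussianReal 0 v) P)
    (hind : Indep (MeasurableSpace.comap D (borel ℝ)) m P)
    {a b : ℝ → ℝ} (ha : Measurable a) (hb : Measurable b) {S : Set ℝ} (hS : MeasurableSet S)
    {x : ℝ} (hx : 0 ≤ x) :
    (gaussianReal 0 v).real (Set.Ici x) * P.real {ω | Y ω ∈ S} ≤
      P.real {ω | Y ω ∈ S ∧ |a (Y ω)| + |b (Y ω)| * x ≤ |a (Y ω) + b (Y ω) * D ω|} := by
  have hbor : borel ℝ = Real.measurableSpace := (BorelSpace.measurable_eq (α := ℝ)).symm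
  have hreal : ∀ B : Set ℝ, MeasurableSet B →
      P.real {ω | D ω ∈ B} = (gaussianReal 0 v).real B := by
    intro B hB
    rw [← hD.map_eq, map_measureReal_apply_of_aemeasurable hD.aemeasurable hB]
    rfl
  have hprod : ∀ (B C : Set ℝ), MeasurableSet B → MeasurableSet C →
      P.real ({ω | D ω ∈ B} ∩ {ω | Y ω ∈ C}) =
        P.real {ω | D ω ∈ B} * P.real {ω | Y ω ∈ C} := by
    intro B C hB hC
    have := (Indep_iff _ _ _).1 hind {ω | D ω ∈ B} {ω | Y ω ∈ C}
      ⟨B, by rwa [hbor], rfl⟩ (hY hC)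
    rw [Measure.real, this, ENNReal.toReal_mul]
    rfl
  -- The favourable sign of `D` depends on `Y` alone, hence is independent of `D`. The upper tail is
  -- used on `Sp` and the lower tail on `Sn`; by symmetry both have the same mass.
  set Sp : Set ℝ := S ∩ {y | 0 ≤ a y * b y}
  set Sn : Set ℝ := S ∩ {y | a y * b y < 0}
  have hSp : MeasurableSet Sp := hS.inter (measurableSet_le measurable_const (ha.mul hb))
  have hSn : MeasurableSet Sn := hS.inter (measurableSet_lt (ha.mul hb) measurable_const)
  have hsplit : P.real {ω | Y ω ∈ S} = P.real {ω | Y ω ∈ Sp} + P.real {ω | Y ω ∈ Sn} := by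
    rw [← measureReal_union (s₂ := {ω | Y ω ∈ Sn}) _ (hm _ (hY hSn))]
    · congr 1
      ext ω
      simp only [Sp, Sn, Set.mem_ofPred_eq, Set.mem_union, Set.mem_inter_iff]
      rcases le_or_gt 0 (a (Y ω) * b (Y ω)) with h | h <;> tauto
    · rw [Set.disjoint_left]
      intro ω h1 h2
      exact not_lt.2 (Set.mem_ofPred.1 h1.2) (Set.mem_ofPred.1 h2.2)
  rw [hsplit, mul_add]
  calc (gaussianReal 0 v).real (Set.Ici x) * P.real {ω | Y ω ∈ Sp} +
        (gaussianReal 0 v).real (Set.Ici x) * P.real {ω | Y ω ∈ Sn}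
      = P.real ({ω | D ω ∈ Set.Ici x} ∩ {ω | Y ω ∈ Sp}) +
          P.real ({ω | D ω ∈ Set.Iic (-x)} ∩ {ω | Y ω ∈ Sn}) := by
        rw [hprod _ _ measurableSet_Ici hSp, hprod _ _ measurableSet_Iic hSn,
          hreal _ measurableSet_Ici, hreal _ measurableSet_Iic, gaussianReal_real_Iic_neg]
    _ = P.real (({ω | D ω ∈ Set.Ici x} ∩ {ω | Y ω ∈ Sp}) ∪
          ({ω | D ω ∈ Set.Iic (-x)} ∩ {ω | Y ω ∈ Sn})) := by
        refine (measureReal_union₀ ?_ ?_).symm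
        · exact (hD.aemeasurable.nullMeasurable measurableSet_Iic).inter
            (hm _ (hY hSn)).nullMeasurableSet
        · refine Disjoint.aedisjoint ?_
          rw [Set.disjoint_left]
          intro ω h1 h2
          exact not_lt.2 (Set.mem_ofPred.1 h1.2.2) (Set.mem_ofPred.1 h2.2.2)
    _ ≤ _ := by
        refine measureReal_mono ?_
        rintro ω (⟨h1, h2⟩ | ⟨h1, h2⟩)
        · exact ⟨h2.1, abs_add_mul_le_abs_add_mul hx (Or.inl ⟨h2.2, h1⟩)⟩
        · exact ⟨h2.1, abs_add_mul_le_abs_add_mul hx (Or.inr ⟨h2.2, h1⟩)⟩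

/-- One Euler step of size `h` raises a large state to the power `γ = (1 + α) / 2`. -/
lemma rpow_le_of_growth {α c h r y m s : ℝ} (hα : 1 < α) (hc : 1 < c) (hh : 0 < h) (hr : 1 ≤ r)
    (hrh : 2 * c ≤ h * r ^ ((α - 1) / 2)) (hy : r ≤ |y|) (hg : |y| ^ α / c ≤ |m| + |s|) :
    r ^ ((1 + α) / 2) ≤ |y + m * h| + |s| * h := by
  have hy1 : 1 ≤ |y| := hr.trans hy
  have hy0 : 0 < |y| := by linarith
  -- The surplus power (α - 1)/2 pays for the small step `h` and for `c`, with a factor 2 left over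
  -- to absorb the subtracted |y|.
  have h1 : |y| ^ α = |y| ^ ((1 + α) / 2) * |y| ^ ((α - 1) / 2) := by
    rw [← Real.rpow_add hy0]; congr 1; ring
  have h2 : r ^ ((α - 1) / 2) ≤ |y| ^ ((α - 1) / 2) :=
    Real.rpow_le_rpow (by linarith) hy (by linarith)
  have h3 : r ^ ((1 + α) / 2) ≤ |y| ^ ((1 + α) / 2) :=
    Real.rpow_le_rpow (by linarith) hy (by linarith)
  have h4 : |y| ≤ |y| ^ ((1 + α) / 2) := Real.self_le_rpow_of_one_le hy1 (by linarith)
  have h5 : 2 * |y| ^ ((1 + α) / 2) ≤ h * (|m| + |s|) := by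
    have h6 : 2 * c ≤ h * |y| ^ ((α - 1) / 2) := hrh.trans (by gcongr)
    have h7 : 2 * |y| ^ ((1 + α) / 2) ≤ h * (|y| ^ α / c) := by
      rw [← mul_div_assoc, le_div_iff₀ (by linarith), h1]
      have : 0 ≤ |y| ^ ((1 + α) / 2) := by positivity
      nlinarith
    exact h7.trans (by gcongr)
  have h8 : |m| * h - |y| ≤ |y + m * h| := by
    have := abs_sub_abs_le_abs_sub (m * h) (-y)
    rw [abs_neg, abs_mul, abs_of_pos hh, sub_neg_eq_add, add_comm (m * h)] at this
    exact this
  nlinarith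

end MLMCEuler

/-! ### Moments, adaptedness and law of the Euler scheme -/

namespace MLMCEuler

/-- A measurable function of at most polynomial growth. -/
def HasPolynomialGrowth (g : ℝ → ℝ) : Prop :=
  Measurable g ∧ ∃ K c : ℝ, 0 < c ∧ 0 ≤ K ∧ ∀ x, |g x| ≤ K * (1 + |x| ^ c)

/-- A random variable all of whose absolute moments are finite. -/
def HasMoments {Ω : Type*} {mΩ : MeasurableSpace Ω} (P : Measure Ω) (Y : Ω → ℝ) : Prop :=
  ∀ p : ℝ≥0, MemLp Y p P

variable {Ω : Type*} {mΩ : MeasurableSpace Ω} {P : Measure Ω}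

lemma HasMoments.add {Y Z : Ω → ℝ} (hY : HasMoments P Y) (hZ : HasMoments P Z) :
    HasMoments P (fun ω => Y ω + Z ω) := fun p => (hY p).add (hZ p)

/-- Hölder's inequality with both exponents doubled; having all moments at once is what makes the
class closed under products. -/
lemma HasMoments.mul {Y Z : Ω → ℝ} (hY : HasMoments P Y) (hZ : HasMoments P Z) :
    HasMoments P (fun ω => Y ω * Z ω) := by
  intro p
  have h2 : ((2 * p : ℝ≥0) : ℝ≥0∞).HolderTriple ((2 * p : ℝ≥0) : ℝ≥0∞) (p : ℝ≥0∞) := by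
    constructor
    push_cast
    rw [ENNReal.mul_inv (by simp) (by simp), ← add_mul, ENNReal.inv_two_add_inv_two, one_mul]
  exact (hZ (2 * p)).mul (hY (2 * p))

lemma HasMoments.abs_rpow {Y : Ω → ℝ} (hY : HasMoments P Y) {c : ℝ} (hc : 0 < c) :
    HasMoments P (fun ω => |Y ω| ^ c) := by
  intro p
  have h := (hY (p * c.toNNReal)).norm_rpow_div (c.toNNReal : ℝ≥0∞)
  have hc' : (c.toNNReal : ℝ≥0∞) ≠ 0 := by simpa using hc
  rw [ENNReal.coe_mul, ENNReal.mul_div_cancel_right hc' (by simp)] at h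
  simpa [hc.le] using h

lemma HasMoments.comp [IsProbabilityMeasure P] {Y : Ω → ℝ} (hY : HasMoments P Y) {g : ℝ → ℝ}
    (hg : HasPolynomialGrowth g) : HasMoments P (fun ω => g (Y ω)) := by
  obtain ⟨hm, K, c, hc, hK, hg⟩ := hg
  intro p
  have h1 : MemLp (fun ω => K * (1 + |Y ω| ^ c)) p P :=
    ((memLp_const (1 : ℝ)).add (hY.abs_rpow hc p)).const_mul K
  refine h1.mono' ?_ (.of_forall fun ω => hg (Y ω))
  exact (hm.comp_aemeasurable (hY 0).1.aemeasurable).aestronglyMeasurable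

lemma HasMoments.integrable {Y : Ω → ℝ} (hY : HasMoments P Y) : Integrable Y P :=
  memLp_one_iff_integrable.1 (hY 1)

lemma HasMoments.of_hasLaw_gaussianReal {D : Ω → ℝ} {m : ℝ} {v : ℝ≥0}
    (hD : HasLaw D (gaussianReal m v) P) : HasMoments P D := by
  intro p
  have h := memLp_id_gaussianReal (μ := m) (v := v) p
  rw [← hD.map_eq, memLp_map_measure_iff aestronglyMeasurable_id hD.aemeasurable] at h
  exact h

lemma HasMoments.of_identDistrib {Y Z : Ω → ℝ} (hZ : HasMoments P Z)
    (h : IdentDistrib Y Z P P) : HasMoments P Y := fun p => h.memLp_iff.2 (hZ p)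

lemma hasMoments_of_integrable [IsProbabilityMeasure P] {Y : Ω → ℝ} (hY : AEStronglyMeasurable Y P)
    (h : ∀ p : ℝ, 1 ≤ p → Integrable (fun ω => |Y ω| ^ p) P) : HasMoments P Y := by
  intro p
  -- Moments are given only for exponents at least 1; smaller ones follow by monotonicity on a
  -- probability space.
  have h1 : MemLp Y ((p + 1 : ℝ≥0) : ℝ≥0∞) P := by
    rw [← integrable_norm_rpow_iff hY (by simp) (by simp)]
    have := h (p + 1) (by simp)
    simpa [ENNReal.toReal_add] using this
  exact h1.mono_exponent (by exact_mod_cast (by simp : p ≤ p + 1))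

lemma hasPolynomialGrowth_of_continuous {g : ℝ → ℝ} (hg : Continuous g) {c : ℝ} (hc : 0 < c)
    (h : ∀ x, c ≤ |x| → |g x| ≤ c * |x| ^ c) : HasPolynomialGrowth g := by
  obtain ⟨C, hC⟩ := (isCompact_Icc (a := -c) (b := c)).exists_bound_of_continuousOn
    hg.continuousOn
  refine ⟨hg.measurable, c + |C|, c, hc, by positivity, fun x => ?_⟩
  have hx : 0 ≤ |x| ^ c := by positivity
  rcases le_total c |x| with h1 | h1
  · nlinarith [h x h1, abs_nonneg C]
  · have h2 : |g x| ≤ C := hC x (abs_le.1 h1)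
    nlinarith [le_abs_self C, abs_nonneg C]

variable {T : ℝ} [Fact (0 < T)] {𝓕 : Filtration (TimeInterval T) mΩ}

lemma gridTime_zero (N : ℕ) : gridTime T N 0 = ⊥ := by
  have h : (0 : ℝ) < T := Fact.out
  apply Subtype.ext
  simp [gridTime, Set.projIcc, h.le]

lemma gridTime_coe {N n : ℕ} (hn : n ≤ N) : (gridTime T N n : ℝ) = n * T / N := by
  have h : (0 : ℝ) < T := Fact.out
  rw [gridTime, Set.projIcc_of_mem]
  refine ⟨by positivity, ?_⟩
  rcases Nat.eq_zero_or_pos N with rfl | hN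
  · simp [h.le]
  · rw [div_le_iff₀ (by positivity), mul_comm T]
    gcongr

lemma measurable_euler {μ σ : ℝ → ℝ} (hμ : Measurable μ) (hσ : Measurable σ)
    {W : TimeInterval T → Ω → ℝ} (hW : IsStandardBrownianMotion 𝓕 P W) {ξ : Ω → ℝ}
    (hξ : Measurable[𝓕 ⊥] ξ) (N n : ℕ) : Measurable[𝓕 (gridTime T N n)] (euler μ σ W ξ N n) := by
  induction n with
  | zero => rw [gridTime_zero]; exact hξ
  | succ n ih =>
    have hle : gridTime T N n ≤ gridTime T N (n + 1) := by
      refine Set.monotone_projIcc _ ?_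
      have h : (0 : ℝ) < T := Fact.out
      push_cast
      gcongr
      linarith
    have ih' := ih.mono (𝓕.mono hle) le_rfl
    have hw := (hW.adapted (gridTime T N n)).mono (𝓕.mono hle) le_rfl
    exact (ih'.add ((hμ.comp ih').mul_const _)).add
      ((hσ.comp ih').mul ((hW.adapted _).sub hw))

lemma hasLaw_increment {W : TimeInterval T → Ω → ℝ} (hW : IsStandardBrownianMotion 𝓕 P W)
    {N n : ℕ} (hn : n < N) :
    HasLaw (fun ω => W (gridTime T N (n + 1)) ω - W (gridTime T N n) ω)
      (gaussianReal 0 (T / N).toNNReal) P := by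
  have h : (0 : ℝ) < T := Fact.out
  have hN : (0 : ℝ) < N := by exact_mod_cast (by omega : 0 < N)
  have h1 := gridTime_coe (T := T) hn.le
  have h2 := gridTime_coe (T := T) (Nat.succ_le_of_lt hn)
  have h3 : (gridTime T N (n + 1) : ℝ) - gridTime T N n = T / N := by
    rw [h1, h2]; push_cast; field_simp; ring
  have hle : gridTime T N n ≤ gridTime T N (n + 1) := by
    rw [← Subtype.coe_le_coe, ← sub_nonneg, h3]; positivity
  have := hW.increment_law _ _ hle
  rwa [h3] at this

lemma indep_increment {W : TimeInterval T → Ω → ℝ} (hW : IsStandardBrownianMotion 𝓕 P W)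
    (N n : ℕ) :
    Indep (MeasurableSpace.comap
      (fun ω => W (gridTime T N (n + 1)) ω - W (gridTime T N n) ω) (borel ℝ))
      (𝓕 (gridTime T N n)) P := by
  refine hW.increment_indep _ _ (Set.monotone_projIcc _ ?_)
  have h : (0 : ℝ) < T := Fact.out
  push_cast
  gcongr
  linarith

lemma hasMoments_euler [IsProbabilityMeasure P] {μ σ : ℝ → ℝ} (hμ : HasPolynomialGrowth μ) (hσ : HasPolynomialGrowth σ)
    {W : TimeInterval T → Ω → ℝ} (hW : IsStandardBrownianMotion 𝓕 P W) {ξ : Ω → ℝ}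
    (hξ : HasMoments P ξ) {N n : ℕ} (hn : n ≤ N) : HasMoments P (euler μ σ W ξ N n) := by
  induction n with
  | zero => exact hξ
  | succ n ih =>
    have ih' := ih (by omega)
    exact (ih'.add ((ih'.comp hμ).mul fun p => memLp_const _)).add
      ((ih'.comp hσ).mul (.of_hasLaw_gaussianReal (hasLaw_increment hW hn)))

/-- The current state is independent of the next increment, so the law of the pair is a product of
two laws that do not depend on the path; one step is a fixed measurable map of that pair. -/
lemma identDistrib_euler [IsProbabilityMeasure P] {μ σ : ℝ → ℝ} (hμ : Measurable μ) (hσ : Measurable σ)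
    {W W' : TimeInterval T → Ω → ℝ} (hW : IsStandardBrownianMotion 𝓕 P W)
    (hW' : IsStandardBrownianMotion 𝓕 P W') {ξ ξ' : Ω → ℝ} (hξ : Measurable[𝓕 ⊥] ξ)
    (hξ' : Measurable[𝓕 ⊥] ξ') (h : IdentDistrib ξ ξ' P P) {N n : ℕ} (hn : n ≤ N) :
    IdentDistrib (euler μ σ W ξ N n) (euler μ σ W' ξ' N n) P P := by
  induction n with
  | zero => exact h
  | succ n ih =>
    have hbor : borel ℝ = Real.measurableSpace := (BorelSpace.measurable_eq (α := ℝ)).symm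
    have hind : ∀ {V : TimeInterval T → Ω → ℝ} {η : Ω → ℝ}, IsStandardBrownianMotion 𝓕 P V →
        Measurable[𝓕 ⊥] η → IndepFun (euler μ σ V η N n)
          (fun ω => V (gridTime T N (n + 1)) ω - V (gridTime T N n) ω) P := by
      intro V η hV hη
      rw [IndepFun_iff_Indep]
      have h1 := (indep_increment hV N n).symm
      rw [hbor] at h1
      exact indep_of_indep_of_le_left h1 (measurable_euler hμ hσ hV hη N n).comap_le
    have hp := (ih (by omega)).prodMk
      ((hasLaw_increment hW hn).identDistrib (hasLaw_increment hW' hn))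
      (hind hW hξ) (hind hW' hξ')
    have hg : Measurable fun q : ℝ × ℝ => q.1 + μ q.1 * (T / N) + σ q.1 * q.2 := by fun_prop
    exact hp.comp hg

end MLMCEuler

/-! ### Divergence of the absolute moments of one Euler path -/

namespace MLMCEuler

variable {Ω : Type*} {mΩ : MeasurableSpace Ω} {P : Measure Ω}
  {T : ℝ} [Fact (0 < T)] {𝓕 : Filtration (TimeInterval T) mΩ}
  {μ σ : ℝ → ℝ} {W : TimeInterval T → Ω → ℝ} {ξ : Ω → ℝ}

/-- A lower bound, uniform in the step size, for the probability that the Brownian increment over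
one step exceeds the step size. -/
noncomputable def stepProb (T : ℝ) : ℝ := (√(2 * Real.pi))⁻¹ * Real.exp (-(T + 1))

lemma stepProb_pos (T : ℝ) : 0 < stepProb T := by unfold stepProb; positivity

/-- Asking the increment to exceed h = T/N puts |σ|h on the same scale as the drift |μ|h, so growth
of |μ| + |σ| suffices whichever term dominates. With x = v = h the Gaussian exponent is h + 1 ≤ T +
1. -/
lemma stepProb_mul_le_euler_succ [IsProbabilityMeasure P] (hμ : Measurable μ) (hσ : Measurable σ)
    (hW : IsStandardBrownianMotion 𝓕 P W) (hξ : Measurable[𝓕 ⊥] ξ)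
    {α c : ℝ} (hα : 1 < α) (hc : 1 < c)
    (hgrowth : ∀ x : ℝ, c ≤ |x| → |x| ^ α / c ≤ |μ x| + |σ x|)
    {N n : ℕ} (hn : n < N) {r : ℝ} (hr : c ≤ r)
    (hrN : 2 * c ≤ T / N * r ^ ((α - 1) / 2)) :
    stepProb T * P.real {ω | r ≤ |euler μ σ W ξ N n ω|} ≤
      P.real {ω | r ^ ((1 + α) / 2) ≤ |euler μ σ W ξ N (n + 1) ω|} := by
  have hT : (0 : ℝ) < T := Fact.out
  have hN : (0 : ℝ) < N := by exact_mod_cast (by omega : 0 < N)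
  have hN1 : (1 : ℝ) ≤ N := by exact_mod_cast (by omega : 1 ≤ N)
  have hh : 0 < T / N := by positivity
  have hv : (T / N).toNNReal ≠ 0 := by simpa using hh
  have hq : stepProb T ≤ (gaussianReal 0 (T / N).toNNReal).real (Set.Ici (T / N)) := by
    refine le_trans ?_ (le_gaussianReal_real_Ici hv hh.le)
    unfold stepProb
    gcongr
    rw [Real.coe_toNNReal _ hh.le, sq, mul_div_assoc, div_self hh.ne', mul_one]
    exact div_le_self hT.le hN1
  have key := measureReal_mul_le_abs_add_mul (𝓕.le _) (measurable_euler hμ hσ hW hξ N n)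
    (hasLaw_increment hW hn) (indep_increment hW N n)
    (a := fun y => y + μ y * (T / N)) (b := σ) (by fun_prop) hσ
    (S := {y | r ≤ |y|}) (measurableSet_le measurable_const measurable_id.abs) hh.le
  calc stepProb T * P.real {ω | r ≤ |euler μ σ W ξ N n ω|}
      ≤ _ := mul_le_mul_of_nonneg_right hq measureReal_nonneg
    _ ≤ _ := key
    _ ≤ _ := by
        refine measureReal_mono fun ω hω => ?_
        obtain ⟨h1, h2⟩ := hω
        exact (rpow_le_of_growth hα hc hh (hc.le.trans hr) hrN h1
          (hgrowth _ (hr.trans h1))).trans h2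

/-- The levels increase, so the two conditions imposed on `r` persist and the one-step bound can be
iterated. -/
lemma stepProb_pow_mul_le_euler [IsProbabilityMeasure P] (hμ : Measurable μ) (hσ : Measurable σ)
    (hW : IsStandardBrownianMotion 𝓕 P W) (hξ : Measurable[𝓕 ⊥] ξ)
    {α c : ℝ} (hα : 1 < α) (hc : 1 < c)
    (hgrowth : ∀ x : ℝ, c ≤ |x| → |x| ^ α / c ≤ |μ x| + |σ x|)
    {N : ℕ} {r : ℝ} (hr : c ≤ r) (hrN : 2 * c ≤ T / N * r ^ ((α - 1) / 2)) (j : ℕ)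
    (hj : j + 1 ≤ N) :
    stepProb T ^ j * P.real {ω | r ≤ |euler μ σ W ξ N 1 ω|} ≤
      P.real {ω | r ^ (((1 + α) / 2) ^ j) ≤ |euler μ σ W ξ N (j + 1) ω|} := by
  induction j with
  | zero => simp
  | succ j ih =>
    have hr1 : 1 ≤ r := hc.le.trans hr
    have hge : r ≤ r ^ (((1 + α) / 2) ^ j) :=
      Real.self_le_rpow_of_one_le hr1 (one_le_pow₀ (by linarith))
    have hT : (0 : ℝ) < T := Fact.out
    have h1 := stepProb_mul_le_euler_succ hμ hσ hW hξ hα hc hgrowth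
      (n := j + 1) (by omega : j + 1 < N) (hr.trans hge) (hrN.trans (by gcongr))
    rw [← Real.rpow_mul (by linarith), ← pow_succ] at h1
    refine le_trans ?_ h1
    rw [pow_succ', mul_assoc]
    exact mul_le_mul_of_nonneg_left (ih (by omega)) (stepProb_pos T).le

/-- Noise in the first step makes `|Y₁|` polynomially large with at most exponentially small
probability. -/
lemma exists_exp_le_euler_one_of_noise [IsProbabilityMeasure P] (hμ : Measurable μ) (hσ : Measurable σ)
    (hW : IsStandardBrownianMotion 𝓕 P W) (hξ : Measurable[𝓕 ⊥] ξ)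
    (hnoise : 0 < P {ω | σ (ξ ω) ≠ 0}) {ρ : ℝ} (hρ : 0 ≤ ρ) (κ : ℕ) :
    ∃ a A : ℝ, ∃ m : ℕ, 0 < a ∧ ∀ N : ℕ, 1 ≤ N →
      a * Real.exp (-(A * (N : ℝ) ^ m)) ≤
        P.real {ω | ρ * (N : ℝ) ^ κ ≤ |euler μ σ W ξ N 1 ω|} := by
  have hT : (0 : ℝ) < T := Fact.out
  -- These sets exhaust the event σ(ξ) ≠ 0, so by countable subadditivity one is not null.
  obtain ⟨i, hi⟩ : ∃ i : ℕ, P {ω | 1 / ((i : ℝ) + 1) ≤ |σ (ξ ω)|} ≠ 0 := by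
    by_contra! h
    refine hnoise.ne' (measure_mono_null (fun ω hω => ?_) (measure_iUnion_null h))
    obtain ⟨i, hi⟩ := exists_nat_one_div_lt (abs_pos.2 hω)
    exact Set.mem_iUnion.2 ⟨i, hi.le⟩
  set θ : ℝ := 1 / ((i : ℝ) + 1)
  have hθ : 0 < θ := by positivity
  have hi' : 0 < P.real {ω | θ ≤ |σ (ξ ω)|} :=
    ENNReal.toReal_pos hi (measure_ne_top _ _)
  -- The increment must exceed x = ρN^κ/θ; dividing x² by its variance T/N gives the exponent 2κ + 1
  -- of N.
  refine ⟨(√(2 * Real.pi))⁻¹ * Real.exp (-1) * P.real {ω | θ ≤ |σ (ξ ω)|},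
    ρ ^ 2 / (θ ^ 2 * T), 2 * κ + 1, by positivity, fun N hN => ?_⟩
  have hN0 : (0 : ℝ) < N := by exact_mod_cast hN
  have hh : 0 < T / N := by positivity
  have hv : (T / N).toNNReal ≠ 0 := by simpa using hh
  have hx : 0 ≤ ρ * (N : ℝ) ^ κ / θ := by positivity
  have hξ' : Measurable[𝓕 (gridTime T N 0)] ξ := by rw [gridTime_zero]; exact hξ
  have key := measureReal_mul_le_abs_add_mul (𝓕.le _) hξ' (hasLaw_increment hW hN)
    (indep_increment hW N 0) (a := fun y => y + μ y * (T / N)) (b := σ) (by fun_prop) hσ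
    (S := {y | θ ≤ |σ y|}) (measurableSet_le measurable_const hσ.abs) hx
  have hg := le_gaussianReal_real_Ici hv hx
  calc _ = (√(2 * Real.pi))⁻¹ * Real.exp (-((ρ * (N : ℝ) ^ κ / θ) ^ 2 /
            ((T / N).toNNReal : ℝ) + 1)) * P.real {ω | θ ≤ |σ (ξ ω)|} := by
        rw [Real.coe_toNNReal _ hh.le, neg_add, Real.exp_add]
        have : (ρ * (N : ℝ) ^ κ / θ) ^ 2 / (T / N) =
            ρ ^ 2 / (θ ^ 2 * T) * (N : ℝ) ^ (2 * κ + 1) := by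
          field_simp
          ring
        rw [this]
        ring
    _ ≤ _ := mul_le_mul_of_nonneg_right hg measureReal_nonneg
    _ ≤ _ := key
    _ ≤ _ := by
        refine measureReal_mono fun ω hω => ?_
        obtain ⟨h1, h2⟩ := hω
        refine le_trans ?_ h2
        have h3 : ρ * (N : ℝ) ^ κ = θ * (ρ * (N : ℝ) ^ κ / θ) := by field_simp
        calc ρ * (N : ℝ) ^ κ = θ * (ρ * (N : ℝ) ^ κ / θ) := h3
          _ ≤ |σ (ξ ω)| * (ρ * (N : ℝ) ^ κ / θ) := mul_le_mul_of_nonneg_right h1 hx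
          _ ≤ _ := le_add_of_nonneg_left (abs_nonneg _)

/-- At a level polynomial in N the assumed tail is the exponential of minus a power of N; κβ is
rounded up to a natural exponent. -/
lemma exists_exp_le_of_heavy_tail {β : ℝ} (hβ : 1 < β)
    (h : ∀ x : ℝ, 1 ≤ x → β ^ (-(x ^ β)) ≤ P.real {ω | x ≤ |ξ ω|})
    {ρ : ℝ} (hρ : 1 ≤ ρ) (κ : ℕ) :
    ∃ A : ℝ, ∃ m : ℕ, ∀ N : ℕ, 1 ≤ N →
      Real.exp (-(A * (N : ℝ) ^ m)) ≤ P.real {ω | ρ * (N : ℝ) ^ κ ≤ |ξ ω|} := by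
  refine ⟨Real.log β * ρ ^ β, ⌈κ * β⌉₊, fun N hN => ?_⟩
  have hN1 : (1 : ℝ) ≤ N := by exact_mod_cast hN
  refine le_trans ?_ (h _ (one_le_mul_of_one_le_of_one_le hρ (one_le_pow₀ hN1)))
  rw [Real.rpow_def_of_pos (by linarith : 0 < β), mul_neg, mul_assoc]
  have hl : 0 ≤ Real.log β := Real.log_nonneg hβ.le
  rw [Real.mul_rpow (by linarith) (by positivity)]
  gcongr
  rw [← Real.rpow_natCast (N : ℝ) κ, ← Real.rpow_mul (by linarith), ← Real.rpow_natCast]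
  exact Real.rpow_le_rpow_of_exponent_le hN1 (Nat.le_ceil _)

/-- The final balance on the logarithmic scale: γ^N from the size of the path, N^m from the cost of
the first step, N from the cost of the later ones. -/
lemma tendsto_exp_pow_sub_atTop {γ : ℝ} (hγ : 1 < γ) {b : ℝ} (hb : 0 < b) (A B : ℝ) (m : ℕ) :
    Tendsto (fun N : ℕ => Real.exp (b * γ ^ N - A * (N : ℝ) ^ m - B * N)) atTop atTop := by
  refine Real.tendsto_exp_atTop.comp ?_
  have h1 : Tendsto (fun N : ℕ => b - A * ((N : ℝ) ^ m / γ ^ N) - B * ((N : ℝ) ^ 1 / γ ^ N))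
      atTop (𝓝 (b - A * 0 - B * 0)) :=
    ((tendsto_const_nhds.sub
      ((tendsto_pow_const_div_const_pow_of_one_lt m hγ).const_mul A))).sub
      ((tendsto_pow_const_div_const_pow_of_one_lt 1 hγ).const_mul B)
  have h2 := (tendsto_pow_atTop_atTop_of_one_lt hγ).atTop_mul_pos (by simpa using hb) h1
  refine h2.congr fun N => ?_
  have : γ ^ N ≠ 0 := by positivity
  field_simp

/-- Strong divergence of the Euler method. -/
theorem tendsto_integral_abs_rpow_euler [IsProbabilityMeasure P]
    (hμ : HasPolynomialGrowth μ) (hσ : HasPolynomialGrowth σ)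
    (hW : IsStandardBrownianMotion 𝓕 P W) (hξ : Measurable[𝓕 ⊥] ξ) (hξmom : HasMoments P ξ)
    {α c : ℝ} (hα : 1 < α) (hc : 1 < c)
    (hgrowth : ∀ x : ℝ, c ≤ |x| → |x| ^ α / c ≤ |μ x| + |σ x|)
    (hnoise : 0 < P {ω | σ (ξ ω) ≠ 0} ∨
      ∃ β : ℝ, 1 < β ∧ ∀ x : ℝ, 1 ≤ x → β ^ (-(x ^ β)) ≤ P.real {ω | x ≤ |ξ ω|})
    {s : ℝ} (hs : 0 < s) :
    Tendsto (fun N : ℕ => ∫ ω, |euler μ σ W ξ N N ω| ^ s ∂P) atTop atTop := by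
  have hT : (0 : ℝ) < T := Fact.out
  set δ : ℝ := (α - 1) / 2 with hδ
  set γ : ℝ := (1 + α) / 2 with hγ
  have hδ0 : 0 < δ := by rw [hδ]; linarith
  have hγ1 : 1 < γ := by rw [hγ]; linarith
  -- With κδ ≥ 1, the power (N^κ)^δ compensates the factor 1/N in the step size. Below, `ρ` is at
  -- least `c` for the growth condition, at least e so that powers of `r` dominate exponentials, and
  -- large enough for ρ^δ ≥ 2c/T.
  set κ : ℕ := ⌈1 / δ⌉₊
  have hκ : 1 ≤ κ * δ := by
    have := Nat.le_ceil (1 / δ)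
    rwa [div_le_iff₀ hδ0] at this
  set ρ : ℝ := max c (max (Real.exp 1) ((2 * c / T) ^ (1 / δ)))
  have hρc : c ≤ ρ := le_max_left _ _
  have hρe : Real.exp 1 ≤ ρ := (le_max_left _ _).trans (le_max_right _ _)
  have hρδ : 2 * c / T ≤ ρ ^ δ := by
    have h1 : (2 * c / T) ^ (1 / δ) ≤ ρ := (le_max_right _ _).trans (le_max_right _ _)
    have h2 := Real.rpow_le_rpow (by positivity) h1 hδ0.le
    rwa [← Real.rpow_mul (by positivity), one_div_mul_cancel hδ0.ne', Real.rpow_one] at h2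
  have hr : ∀ N : ℕ, 1 ≤ N → ρ ≤ ρ * (N : ℝ) ^ κ := fun N hN =>
    le_mul_of_one_le_right (by linarith) (one_le_pow₀ (by exact_mod_cast hN))
  have hrN : ∀ N : ℕ, 1 ≤ N → 2 * c ≤ T / N * (ρ * (N : ℝ) ^ κ) ^ δ := by
    intro N hN
    have hN1 : (1 : ℝ) ≤ N := by exact_mod_cast hN
    rw [Real.mul_rpow (by linarith) (by positivity), ← Real.rpow_natCast (N : ℝ) κ,
      ← Real.rpow_mul (by linarith)]
    have h1 : (N : ℝ) ≤ (N : ℝ) ^ (κ * δ) := Real.self_le_rpow_of_one_le hN1 hκ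
    calc 2 * c = T / N * (2 * c / T * N) := by field_simp
      _ ≤ _ := by gcongr
  obtain ⟨a, A, m, ha, hfirst⟩ : ∃ a A : ℝ, ∃ m : ℕ, 0 < a ∧ ∀ N : ℕ, 1 ≤ N →
      a * Real.exp (-(A * (N : ℝ) ^ m)) ≤
        P.real {ω | ρ * (N : ℝ) ^ κ ≤ |euler μ σ W ξ N 1 ω|} := by
    rcases hnoise with h | ⟨β, hβ, h⟩
    · exact exists_exp_le_euler_one_of_noise hμ.1 hσ.1 hW hξ h (by linarith) κ
    -- Here the initial value is already large; the first step costs a factor `stepProb T`, and its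
    -- gain from r to r^γ is discarded.
    · obtain ⟨A, m, h1⟩ := exists_exp_le_of_heavy_tail hβ h (hc.le.trans hρc) κ
      refine ⟨stepProb T, A, m, stepProb_pos T, fun N hN => ?_⟩
      refine (mul_le_mul_of_nonneg_left (h1 N hN) (stepProb_pos T).le).trans ?_
      refine (stepProb_mul_le_euler_succ hμ.1 hσ.1 hW hξ hα hc hgrowth (n := 0) hN
        (hρc.trans (hr N hN)) (hrN N hN)).trans ?_
      refine measureReal_mono fun ω hω => le_trans ?_ (Set.mem_ofPred.1 hω)
      exact Real.self_le_rpow_of_one_le (by linarith [hr N hN]) hγ1.le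
  -- Only N - 1 steps amplify, whence s·γ^(N-1) = (s/γ)·γ^N.
  have hlim := (tendsto_exp_pow_sub_atTop hγ1 (b := s / γ) (by positivity) A
    |Real.log (stepProb T)| m).const_mul_atTop ha
  refine tendsto_atTop_mono' _ ?_ hlim
  filter_upwards [eventually_ge_atTop 1] with N hN
  obtain ⟨j, rfl⟩ : ∃ j, N = j + 1 := ⟨N - 1, by omega⟩
  set r : ℝ := ρ * ((j + 1 : ℕ) : ℝ) ^ κ with hrdef
  have hrρ := hr _ hN
  have hr0 : 0 < r := by linarith
  have hmain := stepProb_pow_mul_le_euler hμ.1 hσ.1 hW hξ hα hc hgrowth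
    (hρc.trans (hr _ hN)) (hrN _ hN) j le_rfl
  have hmom := (hasMoments_euler hμ hσ hW hξmom (le_refl (j + 1))).abs_rpow hs
  have hmarkov := mul_meas_ge_le_integral_of_nonneg
    (.of_forall fun ω => by positivity) hmom.integrable ((r ^ (γ ^ j)) ^ s)
  have hR : Real.exp (s / γ * γ ^ (j + 1)) ≤ (r ^ (γ ^ j)) ^ s := by
    have h1 : Real.exp 1 ^ (γ ^ j * s) ≤ r ^ (γ ^ j * s) :=
      Real.rpow_le_rpow (Real.exp_pos 1).le (hρe.trans hrρ) (by positivity)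
    rw [← Real.exp_mul, Real.rpow_mul hr0.le, one_mul] at h1
    convert h1 using 2
    field_simp
    rw [pow_succ']
  have hq : Real.exp (-(|Real.log (stepProb T)| * ((j + 1 : ℕ) : ℝ))) ≤ stepProb T ^ j := by
    rw [← Real.exp_log (stepProb_pos T), ← Real.exp_nat_mul, Real.exp_log (stepProb_pos T)]
    gcongr
    have h1 := neg_abs_le (Real.log (stepProb T))
    have h2 := abs_nonneg (Real.log (stepProb T))
    have h3 : (0 : ℝ) ≤ j := by positivity
    push_cast
    nlinarith
  calc a * Real.exp (s / γ * γ ^ (j + 1) - A * ((j + 1 : ℕ) : ℝ) ^ m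
          - |Real.log (stepProb T)| * ((j + 1 : ℕ) : ℝ))
      = Real.exp (s / γ * γ ^ (j + 1)) *
          (Real.exp (-(|Real.log (stepProb T)| * ((j + 1 : ℕ) : ℝ))) *
            (a * Real.exp (-(A * ((j + 1 : ℕ) : ℝ) ^ m)))) := by
        rw [sub_eq_add_neg, sub_eq_add_neg, Real.exp_add, Real.exp_add]
        ring
    _ ≤ (r ^ (γ ^ j)) ^ s * (stepProb T ^ j * P.real {ω | r ≤ |euler μ σ W ξ (j + 1) 1 ω|}) := by
        gcongr
        · exact pow_nonneg (stepProb_pos T).le _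
        · exact hfirst _ hN
    _ ≤ (r ^ (γ ^ j)) ^ s * P.real {ω | r ^ (γ ^ j) ≤ |euler μ σ W ξ (j + 1) (j + 1) ω|} := by
        gcongr
    _ ≤ (r ^ (γ ^ j)) ^ s * P.real {ω | (r ^ (γ ^ j)) ^ s ≤
          |euler μ σ W ξ (j + 1) (j + 1) ω| ^ s} := by
        refine mul_le_mul_of_nonneg_left (measureReal_mono fun ω hω => ?_) (by positivity)
        exact Real.rpow_le_rpow (by positivity) hω hs.le
    _ ≤ _ := hmarkov

end MLMCEuler

/-! ### Telescoping, and bounding the bias by the L^p error -/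

namespace MLMCEuler

variable {Ω : Type*} {mΩ : MeasurableSpace Ω} {P : Measure Ω}

lemma sum_Icc_sub_pred (g : ℕ → ℝ) (L : ℕ) :
    ∑ l ∈ Finset.Icc 1 L, (g l - g (l - 1)) = g L - g 0 := by
  induction L with
  | zero => simp
  | succ L ih => rw [Finset.sum_Icc_succ_top (by omega), ih, Nat.add_sub_cancel]; ring

/-- The multilevel estimator telescopes in expectation. -/
lemma integrable_and_integral_mlmcEuler {T : ℝ} [Fact (0 < T)] {μ σ f : ℝ → ℝ}
    {W : ℕ → ℕ → TimeInterval T → Ω → ℝ} {ξ : ℕ → ℕ → Ω → ℝ} {e : ℕ → ℝ}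
    (hint : ∀ N l k, Integrable (fun ω => f (euler μ σ (W l k) (ξ l k) N N ω)) P)
    (he : ∀ N l k, ∫ ω, f (euler μ σ (W l k) (ξ l k) N N ω) ∂P = e N) (L : ℕ) :
    Integrable (mlmcEuler μ σ W ξ f (2 ^ L)) P ∧
      ∫ ω, mlmcEuler μ σ W ξ f (2 ^ L) ω ∂P = e (2 ^ L) := by
  have hI1 : Integrable (fun ω => (1 / ((2 ^ L : ℕ) : ℝ)) * ∑ k ∈ Finset.range (2 ^ L),
      f (euler μ σ (W 0 k) (ξ 0 k) 1 1 ω)) P :=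
    (integrable_finsetSum _ fun k _ => hint 1 0 k).const_mul _
  have hI2 : ∀ l k, Integrable (fun ω => f (euler μ σ (W l k) (ξ l k) (2 ^ l) (2 ^ l) ω)
      - f (euler μ σ (W l k) (ξ l k) (2 ^ (l - 1)) (2 ^ (l - 1)) ω)) P :=
    fun l k => (hint _ l k).sub (hint _ l k)
  have hI3 : ∀ l, Integrable (fun ω => ((2 : ℝ) ^ l / ((2 ^ L : ℕ) : ℝ)) *
      ∑ k ∈ Finset.range (2 ^ L / 2 ^ l),
        (f (euler μ σ (W l k) (ξ l k) (2 ^ l) (2 ^ l) ω)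
          - f (euler μ σ (W l k) (ξ l k) (2 ^ (l - 1)) (2 ^ (l - 1)) ω))) P :=
    fun l => (integrable_finsetSum _ fun k _ => hI2 l k).const_mul _
  have hI4 := integrable_finsetSum (Finset.Icc 1 (Nat.log 2 (2 ^ L))) fun l _ => hI3 l
  refine ⟨hI1.add hI4, ?_⟩
  -- The weight 2^l/2^L is the inverse of the number 2^(L-l) of samples on level l.
  have hlevel : ∀ l ∈ Finset.Icc 1 L, ((2 : ℝ) ^ l / ((2 ^ L : ℕ) : ℝ)) *
      ∑ k ∈ Finset.range (2 ^ L / 2 ^ l), (e (2 ^ l) - e (2 ^ (l - 1))) =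
        e (2 ^ l) - e (2 ^ (l - 1)) := by
    intro l hl
    have hle : l ≤ L := (Finset.mem_Icc.1 hl).2
    rw [Finset.sum_const, Finset.card_range, nsmul_eq_mul, Nat.pow_div hle (by norm_num),
      ← mul_assoc]
    have : (2 : ℝ) ^ l / ((2 ^ L : ℕ) : ℝ) * ((2 ^ (L - l) : ℕ) : ℝ) = 1 := by
      push_cast
      rw [div_mul_eq_mul_div, ← pow_add, Nat.add_sub_cancel' hle, div_self (by positivity)]
    rw [this, one_mul]
  have hsplit : ∫ ω, mlmcEuler μ σ W ξ f (2 ^ L) ω ∂P = _ := integral_add hI1 hI4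
  rw [hsplit, integral_const_mul, integral_finsetSum _ fun k _ => hint 1 0 k,
    integral_finsetSum _ fun l _ => hI3 l, Nat.log_pow (by norm_num)]
  simp_rw [integral_const_mul]
  have hdiff : ∀ l, ∫ ω, ∑ k ∈ Finset.range (2 ^ L / 2 ^ l),
      (f (euler μ σ (W l k) (ξ l k) (2 ^ l) (2 ^ l) ω)
        - f (euler μ σ (W l k) (ξ l k) (2 ^ (l - 1)) (2 ^ (l - 1)) ω)) ∂P =
      ∑ k ∈ Finset.range (2 ^ L / 2 ^ l), (e (2 ^ l) - e (2 ^ (l - 1))) := by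
    intro l
    rw [integral_finsetSum _ fun k _ => hI2 l k]
    refine Finset.sum_congr rfl fun k _ => ?_
    rw [integral_sub (hint _ l k) (hint _ l k), he, he]
  simp_rw [hdiff, he]
  rw [Finset.sum_congr rfl hlevel, sum_Icc_sub_pred (fun l => e (2 ^ l)), Finset.sum_const,
    Finset.card_range, nsmul_eq_mul]
  have : (1 / ((2 ^ L : ℕ) : ℝ)) * (((2 ^ L : ℕ) : ℝ) * e 1) = e 1 := by
    push_cast
    field_simp
  rw [this, pow_zero]
  ring

/-- An expectation that is bounded below is either a real number or `∞`. -/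
lemma extExpectation_eq_top_or_coe [IsProbabilityMeasure P] {Z : Ω → ℝ} {c : ℝ}
    (hZ : ∀ ω, -c ≤ Z ω) :
    extExpectation P Z = ⊤ ∨ ∃ e : ℝ, extExpectation P Z = e := by
  have hneg : (∫⁻ ω, ENNReal.ofReal (-Z ω) ∂P) ≠ ∞ := by
    refine ne_top_of_le_ne_top (ENNReal.ofReal_ne_top (r := c)) ?_
    calc ∫⁻ ω, ENNReal.ofReal (-Z ω) ∂P ≤ ∫⁻ _, ENNReal.ofReal c ∂P :=
          lintegral_mono fun ω => ENNReal.ofReal_le_ofReal (by linarith [hZ ω])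
      _ = ENNReal.ofReal c := by simp
  unfold extExpectation
  lift (∫⁻ ω, ENNReal.ofReal (-Z ω) ∂P) to ℝ≥0 using hneg with b
  rcases eq_or_ne (∫⁻ ω, ENNReal.ofReal (Z ω) ∂P) ∞ with h | h
  · left
    rw [h]
    exact EReal.top_sub_coe b
  · right
    lift (∫⁻ ω, ENNReal.ofReal (Z ω) ∂P) to ℝ≥0 using h with a
    exact ⟨(a : ℝ) - b, rfl⟩

/-- The inequality x ≤ 1 + x^p stands in for Jensen; the extra 1 is harmless because the left side
will tend to infinity. -/
lemma ofReal_integral_sub_le [IsProbabilityMeasure P] {M : Ω → ℝ} (hM : Integrable M P) (e : ℝ)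
    {p : ℝ} (hp : 1 ≤ p) :
    ENNReal.ofReal (∫ ω, M ω ∂P - e) ≤ 1 + ∫⁻ ω, ((e : EReal) - (M ω : EReal)).abs ^ p ∂P := by
  have habs : ∀ ω, ((e : EReal) - (M ω : EReal)).abs = ‖M ω - e‖ₑ := by
    intro ω
    rw [← EReal.coe_sub, EReal.abs_def, abs_sub_comm, ← Real.norm_eq_abs, ofReal_norm]
  have hint : Integrable (fun ω => M ω - e) P := hM.sub (integrable_const e)
  have hpow : ∀ x : ℝ≥0∞, x ≤ 1 + x ^ p := by
    intro x
    rcases le_total x 1 with h | h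
    · exact h.trans le_self_add
    · exact (ENNReal.le_rpow_self_of_one_le h hp).trans le_add_self
  calc ENNReal.ofReal (∫ ω, M ω ∂P - e) = ENNReal.ofReal (∫ ω, (M ω - e) ∂P) := by
        rw [integral_sub hM (integrable_const e)]; simp
    _ ≤ ENNReal.ofReal (∫ ω, ‖M ω - e‖ ∂P) :=
        ENNReal.ofReal_le_ofReal (integral_mono hint hint.norm fun ω => Real.le_norm_self _)
    _ = ∫⁻ ω, ‖M ω - e‖ₑ ∂P := ofReal_integral_norm_eq_lintegral_enorm hint
    _ ≤ ∫⁻ ω, (1 + ‖M ω - e‖ₑ ^ p) ∂P := lintegral_mono fun ω => hpow _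
    _ = 1 + ∫⁻ ω, ‖M ω - e‖ₑ ^ p ∂P := by
        rw [lintegral_add_left measurable_const]; simp
    _ = _ := by simp_rw [habs]

end MLMCEuler

/-! ### Strong divergence of the multilevel estimator -/

theorem mainTheorem5
    {Ω : Type*} {mΩ : MeasurableSpace Ω} (P : Measure Ω) [IsProbabilityMeasure P]
    (T : ℝ) [Fact (0 < T)]
    (𝓕 : Filtration (MLMCEuler.TimeInterval T) mΩ)
    (h𝓕 : MLMCEuler.IsNormalFiltration 𝓕 P)
    -- the driving Brownian motions; the second index numbers the copies from `0`
    (W : ℕ → ℕ → MLMCEuler.TimeInterval T → Ω → ℝ)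
    (hW : ∀ l k, MLMCEuler.IsStandardBrownianMotion 𝓕 P (W l k))
    (hWindep : iIndepFun
      (fun (q : ℕ × ℕ) (ω : Ω) (t : MLMCEuler.TimeInterval T) => W q.1 q.2 t ω) P)
    -- the initial values
    (ξ : ℕ → ℕ → Ω → ℝ)
    (hξmeas : ∀ l k, Measurable[𝓕 ⊥] (ξ l k))
    (hξindep : iIndepFun (fun q : ℕ × ℕ => ξ q.1 q.2) P)
    (hξident : ∀ l k, IdentDistrib (ξ l k) (ξ 0 0) P P)
    (hξmom : ∀ p : ℝ, 1 ≤ p → Integrable (fun ω => |ξ 0 0 ω| ^ p) P)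
    -- the coefficients and the solution
    (μ σ : ℝ → ℝ) (hμ : Continuous μ) (hσ : Continuous σ)
    (X : MLMCEuler.TimeInterval T → Ω → ℝ)
    (hX : MLMCEuler.IsSDESolution 𝓕 P (W 0 0) (ξ 0 0) μ σ X)
    -- superlinear and at most polynomial growth
    (α c : ℝ) (hα : 1 < α) (hc : 1 < c)
    (hgrowth : ∀ x : ℝ, c ≤ |x| →
      |x| ^ α / c ≤ |μ x| + |σ x| ∧ |μ x| + |σ x| ≤ c * |x| ^ c)
    -- noise in the first step, or heavy tails of the initial value
    (hnoise : 0 < P {ω | σ (ξ 0 0 ω) ≠ 0} ∨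
      ∃ β : ℝ, 1 < β ∧ ∀ x : ℝ, 1 ≤ x → β ^ (-(x ^ β)) ≤ P.real {ω | x ≤ |ξ 0 0 ω|})
    -- the payoff
    (f : ℝ → ℝ) (hf : Measurable f)
    (hfgrowth : ∀ x : ℝ, 1 / c * |x| ^ (1 / c) - c ≤ f x ∧ f x ≤ c * (1 + |x| ^ c)) :
    ∀ p : ℝ, 1 ≤ p →
      Tendsto
        (fun L : ℕ => ∫⁻ ω,
          (MLMCEuler.extExpectation P (fun ω' => f (X ⊤ ω'))
            - (MLMCEuler.mlmcEuler μ σ W ξ f (2 ^ L) ω : EReal)).abs ^ p ∂P)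
        atTop (𝓝 ∞)
 := by
  have hc0 : 0 < c := by linarith
  have hμg : MLMCEuler.HasPolynomialGrowth μ :=
    MLMCEuler.hasPolynomialGrowth_of_continuous hμ hc0 fun x hx => by
      linarith [(hgrowth x hx).2, abs_nonneg (σ x)]
  have hσg : MLMCEuler.HasPolynomialGrowth σ :=
    MLMCEuler.hasPolynomialGrowth_of_continuous hσ hc0 fun x hx => by
      linarith [(hgrowth x hx).2, abs_nonneg (μ x)]
  have hfg : MLMCEuler.HasPolynomialGrowth f := by
    refine ⟨hf, c, c, hc0, hc0.le, fun x => abs_le.2 ⟨?_, (hfgrowth x).2⟩⟩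
    have h1 : 0 ≤ 1 / c * |x| ^ (1 / c) := by positivity
    have h2 : 0 ≤ c * |x| ^ c := by positivity
    linarith [(hfgrowth x).1]
  have hm : ∀ l k, MLMCEuler.HasMoments P (ξ l k) := fun l k =>
    MLMCEuler.HasMoments.of_identDistrib
      (MLMCEuler.hasMoments_of_integrable
        ((hξmeas 0 0).mono (𝓕.le _) le_rfl).aestronglyMeasurable hξmom) (hξident l k)
  have hY : ∀ N l k, MLMCEuler.HasMoments P (MLMCEuler.euler μ σ (W l k) (ξ l k) N N) :=
    fun N l k => MLMCEuler.hasMoments_euler hμg hσg (hW l k) (hm l k) le_rfl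
  have hint : ∀ N l k, Integrable (fun ω => f (MLMCEuler.euler μ σ (W l k) (ξ l k) N N ω)) P :=
    fun N l k => ((hY N l k).comp hfg).integrable
  have he : ∀ N l k, ∫ ω, f (MLMCEuler.euler μ σ (W l k) (ξ l k) N N ω) ∂P =
      ∫ ω, f (MLMCEuler.euler μ σ (W 0 0) (ξ 0 0) N N ω) ∂P := fun N l k =>
    ((MLMCEuler.identDistrib_euler hμg.1 hσg.1 (hW l k) (hW 0 0) (hξmeas l k) (hξmeas 0 0)
      (hξident l k) le_rfl).comp hf).integral_eq
  have hdiv : Tendsto (fun N : ℕ => ∫ ω, f (MLMCEuler.euler μ σ (W 0 0) (ξ 0 0) N N ω) ∂P)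
      atTop atTop := by
    have h1 := MLMCEuler.tendsto_integral_abs_rpow_euler hμg hσg (hW 0 0) (hξmeas 0 0) (hm 0 0)
      hα hc (fun x hx => (hgrowth x hx).1) hnoise (s := 1 / c) (by positivity)
    have h2 := tendsto_atTop_add_const_right atTop (-c)
      (h1.const_mul_atTop (by positivity : 0 < 1 / c))
    refine tendsto_atTop_mono (fun N => ?_) h2
    have h3 := ((hY N 0 0).abs_rpow (by positivity : 0 < 1 / c)).integrable.const_mul (1 / c)
    calc 1 / c * (∫ ω, |MLMCEuler.euler μ σ (W 0 0) (ξ 0 0) N N ω| ^ (1 / c) ∂P) + -c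
        = ∫ ω, (1 / c * |MLMCEuler.euler μ σ (W 0 0) (ξ 0 0) N N ω| ^ (1 / c) - c) ∂P := by
          rw [integral_sub h3 (integrable_const c), integral_const_mul]
          simp [sub_eq_add_neg]
      _ ≤ _ := integral_mono (h3.sub (integrable_const c)) (hint N 0 0)
          fun ω => (hfgrowth _).1
  intro p hp
  rcases MLMCEuler.extExpectation_eq_top_or_coe (P := P) (Z := fun ω => f (X ⊤ ω)) (c := c)
    (fun ω => by
      have h1 : 0 ≤ 1 / c * |X ⊤ ω| ^ (1 / c) := by positivity
      linarith [(hfgrowth (X ⊤ ω)).1]) with h | ⟨e, h⟩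
  -- An infinite target makes the integrand identically ∞.
  · have hp0 : 0 < p := by linarith
    simp only [h, EReal.top_sub_coe, EReal.abs_top, ENNReal.top_rpow_of_pos hp0,
      lintegral_const, measure_univ, mul_one]
    exact tendsto_const_nhds
  · rw [h]
    refine ENNReal.tendsto_nhds_top fun n => ?_
    have h1 : Tendsto (fun L : ℕ =>
        ∫ ω, f (MLMCEuler.euler μ σ (W 0 0) (ξ 0 0) (2 ^ L) (2 ^ L) ω) ∂P - e) atTop atTop :=
      tendsto_atTop_add_const_right atTop (-e)
        (hdiv.comp (tendsto_pow_atTop_atTop_of_one_lt (by norm_num : 1 < 2)))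
    -- The bias must exceed n + 1 to leave n after the 1 lost in `ofReal_integral_sub_le`.
    filter_upwards [h1.eventually_gt_atTop ((n : ℝ) + 1)] with L hL
    obtain ⟨hM, hM'⟩ := MLMCEuler.integrable_and_integral_mlmcEuler hint he L
    have h2 := MLMCEuler.ofReal_integral_sub_le hM e hp
    rw [hM'] at h2
    have h3 : (1 : ℝ≥0∞) + n < ENNReal.ofReal
        (∫ ω, f (MLMCEuler.euler μ σ (W 0 0) (ξ 0 0) (2 ^ L) (2 ^ L) ω) ∂P - e) := by
      rw [ENNReal.lt_ofReal_iff_toReal_lt (by finiteness), ENNReal.toReal_add (by simp) (by simp)]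
      simpa [add_comm] using hL
    exact lt_of_add_lt_add_left (h3.trans_le h2)
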